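/- Let $K$ be an algebraically closed field (e.g. $K=\mathbb{C}$), let $n\ge 0$ and let $V=V^0\oplus\cdots\oplus V^{n+1}$ be a graded $K$-vector space with all $V^i$ finite dimensional (for $V$ concentrated in degrees $0,\dots,n$, take $V^{n+1}=0$). Let $\operatorname{hom}^0(V,V[1])=\prod_{i=0}^{n}\operatorname{Hom}_K(V^i,V^{i+1})$, an affine space with its Zariski topology. For $d=(d^0,\dots,d^n)$ in it write $\operatorname{rk}(d)=(\operatorname{rk}d^0,\dots,\operatorname{rk}d^n)\in\mathbb{N}_0^{n+1}$, and say $d^2=0$ if $d^{i+1}\circ d^i=0$ for $0\le i<n$. Order $\mathbb{N}_0^{n+1}$ componentwise. Let $$\mathcal{D}=\{d \mid d^2=0\},\qquad \mathcal{D}_r=\{d \mid d^2=0,\ \operatorname{rk}(d)=r\}\quad (r\in\mathbb{N}_0^{n+1}),$$ so that $\mathcal{D}$ is the variety of complexes on $V$. (1) For every $r\in\mathbb{N}_0^{n+1}$ with $\mathcal{D}_r\neq\emptyset$, $$\overline{\mathcal{D}_r}=\bigcup_{t\le r}\mathcal{D}_t=\{d \mid d^2=0,\ \operatorname{rk}(d)\le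 r\}.$$ (2) The irreducible components of $\mathcal{D}$ are the closures $\overline{\mathcal{D}_r}$ for $r$ maximal in $\{s\in\mathbb{N}_0^{n+1} \mid \mathcal{D}_s\ne\emptyset\}$; more precisely, $r\mapsto\overline{\mathcal{D}_r}$ is a bijection from the set of these maximal $r$ onto the set of irreducible components of $\mathcal{D}$. -/

import Mathlib

open scoped Topology

namespace VarietyOfComplexes

section Zariski

/-- The algebra of polynomial functions on a `K`-vector space `E`: the `K`-algebra of functions
`E → K` generated by the linear forms on `E`. -/
def polyFun (K : Type*) [Field K] (E : Type*) [AddCommGroup E] [Module K E] :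
    Subalgebra K (E → K) :=
  Algebra.adjoin K (Set.range fun f : Module.Dual K E => (f : E → K))

/-- The common zeros in `E` of a set of functions. -/
def zeros {K : Type*} [Field K] {E : Type*} (S : Set (E → K)) : Set E :=
  {x | ∀ p ∈ S, p x = 0}

/-- The Zariski topology on the affine space underlying a vector space `E` (used for `E` finite
dimensional): the closed sets are the common zeros of sets of polynomial functions. -/
@[reducible] def zariski (K : Type*) [Field K] (E : Type*) [AddCommGroup E] [Module K E] :
    TopologicalSpace E :=
  TopologicalSpace.ofClosed
    {Z | ∃ S : Set (E → K), S ⊆ polyFun K E ∧ Z = zeros S}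
    ⟨{1}, by
      intro p hp
      rw [Set.mem_singleton_iff.mp hp]
      exact one_mem (polyFun K E), by
      ext x
      simp [zeros]⟩
    (by
      intro A hA
      refine ⟨{p | p ∈ polyFun K E ∧ ∃ Z ∈ A, ∀ x ∈ Z, p x = 0}, fun p hp => hp.1, ?_⟩
      ext x
      constructor
      · rintro hx p ⟨_, Z, hZ, hpZ⟩
        exact hpZ x (hx Z hZ)
      · intro hx Z hZ
        obtain ⟨S, hS, rfl⟩ := hA hZ
        exact fun p hp => hx p ⟨hS hp, _, hZ, fun y hy => hy p hp⟩)
    (by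
      rintro _ ⟨S, hS, rfl⟩ _ ⟨T, hT, rfl⟩
      refine ⟨{p | ∃ f ∈ S, ∃ g ∈ T, p = f * g}, ?_, ?_⟩
      · rintro _ ⟨f, hf, g, hg, rfl⟩
        exact mul_mem (hS hf) (hT hg)
      · ext x
        constructor
        · rintro (hx | hx) _ ⟨f, hf, g, hg, rfl⟩
          · simp [hx f hf]
          · simp [hx g hg]
        · intro hx
          by_contra hcon
          simp only [zeros, Set.mem_union, Set.mem_ofPred_eq, not_or, not_forall] at hcon
          obtain ⟨⟨f, hf, hfx⟩, g, hg, hgx⟩ := hcon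
          exact mul_ne_zero hfx hgx (hx (f * g) ⟨f, hf, g, hg, rfl⟩))

/-- The irreducible components of a subset `X` of `E` with its Zariski (subspace) topology,
regarded as subsets of `E`. -/
def components (K : Type*) [Field K] {E : Type*} [AddCommGroup E] [Module K E]
    (X : Set E) : Set (Set E) :=
  (fun Y : Set X => Subtype.val '' Y) ''
    @irreducibleComponents X ((zariski K E).induced Subtype.val)

end Zariski

section Complexes

variable (K : Type*) [Field K] {n : ℕ} (V : Fin (n + 2) → Type*)
  [∀ i, AddCommGroup (V i)] [∀ i, Module K (V i)]

/-- Graded linear maps `d : V → V[1]` for `V = V⁰ ⊕ ⋯ ⊕ Vⁿ⁺¹`: families of linear maps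
`dⁱ : Vⁱ → Vⁱ⁺¹`, `0 ≤ i ≤ n`. For `V` concentrated in degrees `0, …, n` take `Vⁿ⁺¹ = 0`. -/
abbrev HomShift : Type _ :=
  ∀ i : Fin (n + 1), V i.castSucc →ₗ[K] V i.succ

variable {K V}

/-- The condition `d ∘ d = 0`, that is `dⁱ⁺¹ ∘ dⁱ = 0` for all `i`. -/
def SquareZero (d : HomShift K V) : Prop :=
  ∀ (i : Fin n) (x : V i.castSucc.castSucc), d i.succ (d i.castSucc x) = 0

/-- The rank `rk d = (rk d⁰, …, rk dⁿ)`. -/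
noncomputable def rk (d : HomShift K V) : Fin (n + 1) → ℕ :=
  fun i => Module.finrank K (LinearMap.range (d i))

variable (K V)

/-- The variety of complexes: all differentials on the graded vector space `V`. -/
def complexes : Set (HomShift K V) :=
  {d | SquareZero d}

/-- The differentials on `V` of rank exactly `r`. -/
def stratum (r : Fin (n + 1) → ℕ) : Set (HomShift K V) :=
  {d | SquareZero d ∧ rk d = r}

end Complexes

end VarietyOfComplexes

namespace VarietyOfComplexes

/-! ### Irreducible components of a subspace, seen in the ambient space. -/

section Irreducible

variable {X : Type*} [TopologicalSpace X]

/-! The set of complexes of rank at most `r` is closed, being cut out by minors and by the quadratic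
equations `d² = 0`. Conversely, a complex has bases in which every `dⁱ` matches final basis vectors
with initial ones (`SquareZero.exists_isAdapted`). Scaling additional matched pairs by a parameter
`a` gives a line that starts at a complex of rank `t ≤ r` and lies in the stratum of `r` for `a ≠
0`, so the smaller stratum lies in the closure (`stratum_subset_closure`).

The normal form also shows that each stratum is a single orbit under graded automorphisms. Any two
of its points are joined by a polynomial curve lying in the stratum up to finitely many parameters,
so the stratum is irreducible (`exists_isPolyCurve_stratum`). Only finitely many strata are
nonempty, and inclusion of their closures is the order on ranks; hence the closures of the maximal
strata are the components. -/

theorem isIrreducible_image_val {A : Set X} {s : Set A} :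
    IsIrreducible (Subtype.val '' s) ↔ IsIrreducible s := by
  refine ⟨fun h => ⟨by simpa using h.1, ?_⟩,
    fun h => h.image _ continuous_subtype_val.continuousOn⟩
  rintro u v ⟨u, hu, rfl⟩ ⟨v, hv, rfl⟩ ⟨x, hx, hxu⟩ ⟨y, hy, hyv⟩
  obtain ⟨_, ⟨z, hz, rfl⟩, hzu, hzv⟩ :=
    h.2 u v hu hv ⟨x, ⟨x, hx, rfl⟩, hxu⟩ ⟨y, ⟨y, hy, rfl⟩, hyv⟩
  exact ⟨z, hz, hzu, hzv⟩

theorem image_irreducibleComponents (A : Set X) :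
    (fun Y : Set A => Subtype.val '' Y) '' irreducibleComponents A =
      {Y | Maximal (fun s => IsIrreducible s ∧ s ⊆ A) Y} := by
  ext Y
  constructor
  · rintro ⟨Y, hY, rfl⟩
    refine ⟨⟨isIrreducible_image_val.2 hY.1, by simp⟩, ?_⟩
    rintro Z ⟨hZ, hZA⟩ hYZ
    obtain ⟨Z, rfl⟩ : ∃ W : Set A, Subtype.val '' W = Z :=
      ⟨Subtype.val ⁻¹' Z, by simpa using hZA⟩
    exact Set.image_mono
      (hY.2 (isIrreducible_image_val.1 hZ) ((Set.image_subset_image_iff Subtype.val_injective).1 hYZ))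
  · rintro ⟨⟨hY, hYA⟩, hmax⟩
    obtain ⟨Y, rfl⟩ : ∃ W : Set A, Subtype.val '' W = Y :=
      ⟨Subtype.val ⁻¹' Y, by simpa using hYA⟩
    refine ⟨Y, ⟨isIrreducible_image_val.1 hY, fun Z hZ hYZ => ?_⟩, rfl⟩
    exact (Set.image_subset_image_iff Subtype.val_injective).1
      (hmax ⟨isIrreducible_image_val.2 hZ, by simp⟩ (Set.image_mono hYZ))

end Irreducible

/-! ### Polynomial curves as a test for Zariski closures and irreducibility. -/

section Zariski

variable {K : Type*} [Field K] {E : Type*} [AddCommGroup E] [Module K E]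

theorem isClosed_zariski_iff {Z : Set E} :
    IsClosed[zariski K E] Z ↔ ∃ S : Set (E → K), S ⊆ polyFun K E ∧ Z = zeros S := by
  rw [← @isOpen_compl_iff _ _ (zariski K E)]
  change Zᶜᶜ ∈ {Z | ∃ S : Set (E → K), S ⊆ polyFun K E ∧ Z = zeros S} ↔ _
  rw [compl_compl]
  rfl

theorem isClosed_zeros {S : Set (E → K)} (hS : S ⊆ polyFun K E) :
    IsClosed[zariski K E] (zeros S) :=
  isClosed_zariski_iff.2 ⟨S, hS, rfl⟩

theorem dual_mem_polyFun (f : Module.Dual K E) : (f : E → K) ∈ polyFun K E :=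
  Algebra.subset_adjoin ⟨f, rfl⟩

variable (K) in
/-- Polynomial curves in `E`. -/
def IsPolyCurve (c : K → E) : Prop :=
  ∀ f : Module.Dual K E, ∃ P : Polynomial K, ∀ a, f (c a) = P.eval a

theorem IsPolyCurve.exists_eval {c : K → E} (hc : IsPolyCurve K c) {p : E → K}
    (hp : p ∈ polyFun K E) : ∃ P : Polynomial K, ∀ a, p (c a) = P.eval a := by
  induction hp using Algebra.adjoin_induction with
  | mem p hp => obtain ⟨f, rfl⟩ := hp; exact hc f
  | algebraMap k => exact ⟨Polynomial.C k, fun a => by simp⟩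
  | add p q _ _ hp hq =>
    obtain ⟨P, hP⟩ := hp
    obtain ⟨Q, hQ⟩ := hq
    exact ⟨P + Q, fun a => by simp [hP, hQ]⟩
  | mul p q _ _ hp hq =>
    obtain ⟨P, hP⟩ := hp
    obtain ⟨Q, hQ⟩ := hq
    exact ⟨P * Q, fun a => by simp [hP, hQ]⟩

theorem IsPolyCurve.add_smul (x y : E) : IsPolyCurve K fun a : K => x + a • y := fun f =>
  ⟨Polynomial.C (f x) + Polynomial.C (f y) * Polynomial.X, fun a => by simp [mul_comm a]⟩

theorem IsPolyCurve.pi {ι : Type*} [Finite ι] {F : ι → Type*} [∀ i, AddCommGroup (F i)]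
    [∀ i, Module K (F i)] {c : K → ∀ i, F i} (hc : ∀ i, IsPolyCurve K fun a => c a i) :
    IsPolyCurve K c := by
  classical
  cases nonempty_fintype ι
  intro f
  choose P hP using fun i => hc i (f ∘ₗ LinearMap.single K F i)
  refine ⟨∑ i, P i, fun a => ?_⟩
  rw [Polynomial.eval_finsetSum, ← LinearMap.sum_single_apply F (c a), map_sum]
  exact Finset.sum_congr rfl fun i _ => hP i a

theorem IsPolyCurve.map {F : Type*} [AddCommGroup F] [Module K F] {c : K → E}
    (hc : IsPolyCurve K c) (g : E →ₗ[K] F) : IsPolyCurve K fun a => g (c a) :=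
  fun f => hc (f ∘ₗ g)

theorem isPolyCurve_matrix {m n : Type*} [Finite m] [Finite n]
    (M : Matrix m n (Polynomial K)) :
    IsPolyCurve K fun a => M.map (Polynomial.evalRingHom a) := by
  classical
  cases nonempty_fintype m
  cases nonempty_fintype n
  intro f
  refine ⟨∑ i, ∑ j, M i j * Polynomial.C (f (Matrix.single i j 1)), fun a => ?_⟩
  beta_reduce
  rw [Matrix.matrix_eq_sum_single (M.map (Polynomial.evalRingHom a))]
  simp only [map_sum, Polynomial.eval_finsetSum, Polynomial.eval_mul, Polynomial.eval_C]
  refine Finset.sum_congr rfl fun i _ => Finset.sum_congr rfl fun j _ => ?_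
  rw [← smul_eq_mul, ← map_smul, Matrix.smul_single, smul_eq_mul, mul_one]
  rfl

variable [Infinite K]

/-- A polynomial function restricted to the curve is a polynomial in one variable; with infinitely
many roots it is zero, so the exceptional parameters cannot escape `Z`. -/
theorem IsPolyCurve.mem_of_isClosed {c : K → E} (hc : IsPolyCurve K c) {A Z : Set E}
    (hA : {a | c a ∉ A}.Finite) (hZ : IsClosed[zariski K E] Z) (hAZ : A ⊆ Z) (a : K) :
    c a ∈ Z := by
  obtain ⟨S, hS, rfl⟩ := isClosed_zariski_iff.1 hZ
  intro p hp
  obtain ⟨P, hP⟩ := hc.exists_eval (hS hp)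
  have : P = 0 := Polynomial.eq_zero_of_infinite_isRoot P <|
    hA.infinite_compl.mono fun b hb => (hP b).symm.trans (hAZ (not_not.1 hb) p hp)
  simp [hP, this]

theorem IsPolyCurve.mem_closure {c : K → E} (hc : IsPolyCurve K c) {A : Set E}
    (hA : {a | c a ∉ A}.Finite) (a : K) : c a ∈ closure[zariski K E] A :=
  let := zariski K E
  hc.mem_of_isClosed hA isClosed_closure subset_closure a

/-- A set is irreducible if any two of its points lie on a polynomial curve which is contained in
the set up to finitely many parameters. -/
theorem isIrreducible_of_isPolyCurve {A : Set E} (hne : A.Nonempty)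
    (h : ∀ x ∈ A, ∀ y ∈ A, ∃ c : K → E, IsPolyCurve K c ∧ {a | c a ∉ A}.Finite ∧
      x ∈ Set.range c ∧ y ∈ Set.range c) :
    @IsIrreducible E (zariski K E) A := by
  let := zariski K E
  refine ⟨hne, isPreirreducible_iff_isClosed_union_isClosed.2 fun Z₁ Z₂ h₁ h₂ hA => ?_⟩
  by_contra! hcon
  obtain ⟨⟨x, hx, hx₁⟩, y, hy, hy₂⟩ := hcon.imp Set.not_subset.1 Set.not_subset.1
  obtain ⟨c, hc, hfin, ⟨a, rfl⟩, b, rfl⟩ := h x hx y hy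
  obtain ⟨S₁, hS₁, rfl⟩ := isClosed_zariski_iff.1 h₁
  obtain ⟨S₂, hS₂, rfl⟩ := isClosed_zariski_iff.1 h₂
  simp only [zeros, Set.mem_ofPred_eq, not_forall] at hx₁ hy₂
  obtain ⟨p, hp, hpa⟩ := hx₁
  obtain ⟨q, hq, hqb⟩ := hy₂
  obtain ⟨P, hP⟩ := hc.exists_eval (hS₁ hp)
  obtain ⟨Q, hQ⟩ := hc.exists_eval (hS₂ hq)
  have : P * Q = 0 := Polynomial.eq_zero_of_infinite_isRoot _ <|
    hfin.infinite_compl.mono fun t ht => by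
      rcases hA (not_not.1 ht) with h | h
      · simp [← hP, h p hp]
      · simp [← hQ, h q hq]
  rcases mul_eq_zero.1 this with rfl | rfl
  · exact hpa (by simp [hP])
  · exact hqb (by simp [hQ])

end Zariski

/-! ### Rank through minors. -/

section Determinantal

variable {K : Type*} [Field K] {V W : Type*} [AddCommGroup V] [Module K V] [AddCommGroup W]
  [Module K W] [FiniteDimensional K W]

/-- A linear map has rank at least `s` iff one of its `s × s` minors is nonzero. -/
theorem le_finrank_range_iff_exists_det_ne_zero (f : V →ₗ[K] W) (s : ℕ) :
    s ≤ Module.finrank K (LinearMap.range f) ↔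
      ∃ (a : Fin s → V) (c : Fin s → Module.Dual K W),
        (Matrix.of fun p q => c p (f (a q))).det ≠ 0 := by
  classical
  constructor
  · intro h
    obtain ⟨v, hv⟩ := exists_linearIndependent_of_le_finrank h
    have hv' : LinearIndependent K fun p => (v p : W) :=
      hv.map' (LinearMap.range f).subtype (Submodule.ker_subtype _)
    choose a ha using fun p => (v p).2
    -- The coordinates of a left inverse serve as the functionals: they make the minor the identity
    -- matrix.
    obtain ⟨g, hg⟩ := (Fintype.linearCombination K fun p => (v p : W)).exists_leftInverse_of_injective
      (LinearMap.ker_eq_bot.2 hv'.fintypeLinearCombination_injective)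
    refine ⟨a, fun p => LinearMap.proj p ∘ₗ g, ?_⟩
    have : (Matrix.of fun p q => (LinearMap.proj p ∘ₗ g : Module.Dual K W) (f (a q))) = 1 := by
      ext p q
      have h1 := LinearMap.congr_fun hg (Pi.single q 1)
      simp only [LinearMap.comp_apply, Fintype.linearCombination_apply_single, one_smul,
        LinearMap.id_apply] at h1
      simp [ha, h1, Matrix.one_apply, Pi.single_apply]
    rw [this, Matrix.det_one]
    exact one_ne_zero
  · rintro ⟨a, c, h⟩
    have hli : LinearIndependent K fun q => f.rangeRestrict (a q) := by
      rw [Fintype.linearIndependent_iff]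
      intro g hg
      refine congrFun (Matrix.eq_zero_of_mulVec_eq_zero h ?_)
      ext p
      have : c p (∑ q, g q • f.rangeRestrict (a q) : LinearMap.range f) = 0 := by simp [hg]
      simpa [Matrix.mulVec, dotProduct, mul_comm] using this
    simpa using hli.fintype_card_le_finrank

end Determinantal

/-! ### Equations for the rank bound and for `d² = 0`. -/

section Closedness

variable {K : Type*} [Field K] {n : ℕ} {V : Fin (n + 2) → Type*}
  [∀ i, AddCommGroup (V i)] [∀ i, Module K (V i)]

theorem apply_mem_polyFun (i : Fin (n + 1)) (x : V i.castSucc) (f : Module.Dual K (V i.succ)) :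
    (fun d : HomShift K V => f (d i x)) ∈ polyFun K (HomShift K V) :=
  dual_mem_polyFun (f ∘ₗ LinearMap.applyₗ x ∘ₗ
    (LinearMap.proj i : HomShift K V →ₗ[K] V i.castSucc →ₗ[K] V i.succ))

variable [∀ i, FiniteDimensional K (V i)]

theorem isClosed_setOf_rk_le (r : Fin (n + 1) → ℕ) :
    IsClosed[zariski K (HomShift K V)] {d : HomShift K V | rk d ≤ r} := by
  have : {d : HomShift K V | rk d ≤ r} =
      zeros {p | ∃ i, ∃ (a : Fin (r i + 1) → V i.castSucc)
        (c : Fin (r i + 1) → Module.Dual K (V i.succ)),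
        p = fun d : HomShift K V => (Matrix.of fun p q => c p (d i (a q))).det} := by
    ext d
    have key : ∀ i, rk d i ≤ r i ↔ ∀ (a : Fin (r i + 1) → V i.castSucc)
        (c : Fin (r i + 1) → Module.Dual K (V i.succ)),
        (Matrix.of fun p q => c p (d i (a q))).det = 0 := fun i => by
      rw [← not_lt, ← Nat.succ_le_iff, rk, le_finrank_range_iff_exists_det_ne_zero]
      push Not
      rfl
    simp only [Set.mem_ofPred_eq, Pi.le_def, key, zeros]
    constructor
    · rintro h _ ⟨i, a, c, rfl⟩
      exact h i a c
    · exact fun h i a c => h _ ⟨i, a, c, rfl⟩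
  rw [this]
  refine isClosed_zeros ?_
  rintro _ ⟨i, a, c, rfl⟩
  have : (fun d : HomShift K V => (Matrix.of fun p q => c p (d i (a q))).det) =
      ∑ σ : Equiv.Perm (Fin (r i + 1)), algebraMap K (HomShift K V → K) ((Equiv.Perm.sign σ : ℤ) : K) *
        ∏ q, fun d : HomShift K V => c (σ q) (d i (a q)) := by
    ext d
    simp [Matrix.det_apply']
  rw [this]
  exact sum_mem fun σ _ => mul_mem (Subalgebra.algebraMap_mem _ _) <|
    prod_mem fun q _ => apply_mem_polyFun _ _ _

theorem isClosed_complexes : IsClosed[zariski K (HomShift K V)] (complexes K V) := by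
  have : complexes K V = zeros {p | ∃ (i : Fin n) (x : V i.castSucc.castSucc)
      (f : Module.Dual K (V i.succ.succ)),
        p = fun d : HomShift K V => f (d i.succ (d i.castSucc x))} := by
    ext d
    constructor
    · rintro h _ ⟨i, x, f, rfl⟩
      exact (congrArg f (h i x)).trans (map_zero f)
    · exact fun h i x => (Module.forall_dual_apply_eq_zero_iff K _).1 fun f => h _ ⟨i, x, f, rfl⟩
  rw [this]
  refine isClosed_zeros ?_
  rintro _ ⟨i, x, f, rfl⟩
  -- Expanding the intermediate vector in a basis exhibits the composite as a sum of products of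
  -- linear forms in `d`.
  let b := Module.finBasis K (V i.succ.castSucc)
  have : (fun d : HomShift K V => f (d i.succ (d i.castSucc x))) =
      ∑ k, (fun d : HomShift K V => b.coord k (d i.castSucc x)) * fun d => f (d i.succ (b k)) := by
    ext d
    refine (congrArg (fun y => f (d i.succ y)) (b.sum_repr (d i.castSucc x)).symm).trans ?_
    simp [map_sum, -Module.Basis.sum_repr]
  rw [this]
  exact sum_mem fun k _ => mul_mem (apply_mem_polyFun i.castSucc x (b.coord k))
    (apply_mem_polyFun i.succ (b k) f)

theorem isClosed_setOf_squareZero_and_rk_le (r : Fin (n + 1) → ℕ) :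
    IsClosed[zariski K (HomShift K V)] {d : HomShift K V | SquareZero d ∧ rk d ≤ r} :=
  let := zariski K (HomShift K V)
  isClosed_complexes.inter (isClosed_setOf_rk_le r)

end Closedness

/-! ### Bases adapted to a subspace. -/

section Bases

variable {K : Type*} [Field K] {V : Type*} [AddCommGroup V] [Module K V] [FiniteDimensional K V]

theorem exists_basis_extending {s : ℕ} {v : Fin s → V} (hv : LinearIndependent K v) :
    ∃ b : Module.Basis (Fin (Module.finrank K V)) K V, ∀ (j : Fin _) (h : (j : ℕ) < s), b j = v ⟨j, h⟩ := by
  let B := (Module.Basis.span hv).sumQuot (Module.finBasis K (V ⧸ Submodule.span K (Set.range v)))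
  have hcard : s + Module.finrank K (V ⧸ Submodule.span K (Set.range v)) = Module.finrank K V := by
    simp [Module.finrank_eq_card_basis B]
  refine ⟨B.reindex (finSumFinEquiv.trans (finCongr hcard)), fun j h => ?_⟩
  have hj : (finCongr hcard).symm j = Fin.castAdd _ ⟨j, h⟩ := rfl
  simp only [Module.Basis.reindex_apply, Equiv.symm_trans_apply, hj,
    finSumFinEquiv_symm_apply_castAdd, B, Module.Basis.sumQuot_inl, Module.Basis.span_apply]

/-- A basis starting with given vectors of a subspace `Z`, ending with given vectors which are
independent modulo `Z`, with all other vectors in `Z`. -/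
theorem exists_basis_adapted (Z : Submodule K V) {s t : ℕ} (β c : ℕ → V)
    (hβZ : ∀ k < s, β k ∈ Z) (hβ : LinearIndependent K fun k : Fin s => β k)
    (hc : LinearIndependent K fun k : Fin t => Z.mkQ (c k))
    (hdim : Module.finrank K Z + t = Module.finrank K V) :
    ∃ b : Module.Basis (Fin (Module.finrank K V)) K V,
      (∀ j : Fin _, (j : ℕ) < s → b j = β j) ∧
      (∀ j, (j.rev : ℕ) < t → b j = c j.rev) ∧
      (∀ j, t ≤ (j.rev : ℕ) → b j ∈ Z) := by
  have hβ' : LinearIndependent K fun k : Fin s => (⟨β k, hβZ k k.2⟩ : Z) :=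
    LinearIndependent.of_comp Z.subtype hβ
  obtain ⟨bZ, hbZ⟩ := exists_basis_extending hβ'
  -- The reversal puts `c 0` last, so that `c k` sits at distance `k` from the end.
  have hw : LinearIndependent K (Sum.elim (fun j => (bZ j : V)) (fun k : Fin t => c k.rev)) := by
    have := bZ.linearIndependent.sumElim_of_quotient (fun k : Fin t => c k.rev)
      (hc.comp _ Fin.rev_injective)
    exact this
  let e : Fin (Module.finrank K Z) ⊕ Fin t ≃ Fin (Module.finrank K V) :=
    finSumFinEquiv.trans (finCongr hdim)
  have hw' := hw.comp e.symm e.symm.injective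
  have hs : s ≤ Module.finrank K Z := by simpa using hβ'.fintype_card_le_finrank
  have hl : ∀ (j : Fin (Module.finrank K V)) (h : (j : ℕ) < Module.finrank K Z),
      e.symm j = Sum.inl ⟨j, h⟩ := fun j h => by
    rw [Equiv.symm_apply_eq]; rfl
  refine ⟨Module.Basis.mk hw' (hw'.span_eq_top_of_card_eq_finrank' (by simp)).ge, fun j h => ?_, fun j h => ?_,
    fun j h => ?_⟩
  · simp [hl j (h.trans_le hs), hbZ ⟨j, _⟩ h]
  · have hr : e.symm j = Sum.inr (⟨j.rev, h⟩ : Fin t).rev := by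
      rw [Equiv.symm_apply_eq]
      ext
      simp only [Fin.val_rev] at h
      simp [e, Fin.val_rev]
      omega
    simp only [Module.Basis.coe_mk, Function.comp_apply, hr, Sum.elim_inr, Fin.rev_rev]
  · rw [Fin.val_rev] at h
    simp [hl j (by omega)]

end Bases

/-! ### Normal form of a complex. -/

section NormalForm

variable {K : Type*} [Field K] {n : ℕ} {V : Fin (n + 2) → Type*}
  [∀ i, AddCommGroup (V i)] [∀ i, Module K (V i)] [∀ i, FiniteDimensional K (V i)]

/-- The bases `b` put `d` into normal form: `d` maps the last `rk d` basis vectors, in reversed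
order, to the first `rk d` basis vectors, and the other ones to zero. -/
def IsAdapted (d : HomShift K V) (b : ∀ i, Module.Basis (Fin (Module.finrank K (V i))) K (V i)) :
    Prop :=
  ∀ i j, (∀ k : Fin _, (k : ℕ) = (j.rev : ℕ) → (k : ℕ) < rk d i → d i (b i.castSucc j) = b i.succ k) ∧
    (rk d i ≤ (j.rev : ℕ) → d i (b i.castSucc j) = 0)

theorem SquareZero.exists_isAdapted {d : HomShift K V} (hd : SquareZero d) :
    ∃ b : ∀ i, Module.Basis (Fin (Module.finrank K (V i))) K (V i), IsAdapted d b := by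
  have h1 : ∀ i, ∃ c : ℕ → V i.castSucc, LinearIndependent K fun k : Fin (rk d i) => d i (c k) := by
    intro i
    let b := Module.finBasis K (LinearMap.range (d i))
    choose c hc using fun k => (b k).2
    refine ⟨fun k => if h : k < rk d i then c ⟨k, h⟩ else 0, ?_⟩
    have := b.linearIndependent.map' (LinearMap.range (d i)).subtype (Submodule.ker_subtype _)
    have heq : (fun k : Fin (rk d i) => d i (if h : (k : ℕ) < rk d i then c ⟨k, h⟩ else 0)) =
        (LinearMap.range (d i)).subtype ∘ b := by
      ext k
      have hk : (k : ℕ) < rk d i := k.2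
      simp only [dif_pos hk]
      exact hc k
    rwa [heq]
  choose c hc using h1
  -- In each degree, `β` gives a basis of the boundaries (`s` vectors), `Z` is the space of cycles,
  -- and `γ` gives `t` vectors spanning a complement of it. Nothing enters degree `0` and nothing
  -- leaves the top degree, whence the defaults `0` and `⊤`.
  let s : Fin (n + 2) → ℕ := Fin.cases 0 (rk d)
  let β : ∀ i, ℕ → V i := Fin.cases 0 fun i k => d i (c i k)
  obtain ⟨t, htl, ht⟩ : ∃ t : Fin (n + 2) → ℕ, t (Fin.last (n + 1)) = 0 ∧
      ∀ i : Fin (n + 1), t i.castSucc = rk d i :=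
    ⟨Fin.lastCases 0 (rk d), by simp, fun i => by simp⟩
  obtain ⟨Z, hZl, hZ⟩ : ∃ Z : ∀ i, Submodule K (V i), Z (Fin.last (n + 1)) = ⊤ ∧
      ∀ i : Fin (n + 1), Z i.castSucc = LinearMap.ker (d i) :=
    ⟨Fin.lastCases ⊤ fun i => LinearMap.ker (d i), by simp, fun i => by simp⟩
  obtain ⟨γ, hγ⟩ : ∃ γ : ∀ i, ℕ → V i, ∀ i : Fin (n + 1), γ i.castSucc = c i :=
    ⟨Fin.lastCases 0 c, fun i => by simp⟩
  have key : ∀ i, ∃ b : Module.Basis (Fin (Module.finrank K (V i))) K (V i),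
      (∀ j : Fin _, (j : ℕ) < s i → b j = β i j) ∧
      (∀ j, (j.rev : ℕ) < t i → b j = γ i j.rev) ∧
      (∀ j, t i ≤ (j.rev : ℕ) → b j ∈ Z i) := by
    intro i
    apply exists_basis_adapted
    · cases i using Fin.cases with
      | zero => exact fun k hk => absurd hk (Nat.not_lt_zero k)
      | succ i =>
        intro k _
        cases i using Fin.lastCases with
        | last =>
          change _ ∈ Z (Fin.last (n + 1))
          simp [hZl]
        | cast i =>
          change _ ∈ Z (Fin.castSucc i.succ)
          rw [hZ]
          exact hd i _
    · cases i using Fin.cases with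
      | zero => exact linearIndependent_empty_type (ι := Fin 0)
      | succ i => exact hc i
    · cases i using Fin.lastCases with
      | last =>
        rw [htl]
        exact linearIndependent_empty_type
      | cast i =>
        rw [hZ, ht, hγ]
        refine LinearIndependent.of_comp ((LinearMap.ker (d i)).liftQ (d i) le_rfl) ?_
        simpa [Function.comp_def] using hc i
    · cases i using Fin.lastCases with
      | last => rw [hZl, htl, finrank_top, add_zero]
      | cast i =>
        rw [hZ, ht, add_comm]
        exact LinearMap.finrank_range_add_finrank_ker (d i)
  choose b hb1 hb2 hb3 using key
  refine ⟨b, fun i j => ⟨fun k hk hlt => ?_, fun h => ?_⟩⟩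
  · have e1 := hb1 i.succ k hlt
    have e2 := hb2 i.castSucc j (by rw [ht]; omega)
    rw [e1, e2, hγ, ← hk]
    rfl
  · have e3 := hb3 i.castSucc j (by rwa [ht])
    rwa [hZ] at e3

end NormalForm

/-! ### Rank computations and constraints. -/

section Rank

variable {K : Type*} [Field K] {n : ℕ} {V : Fin (n + 2) → Type*}
  [∀ i, AddCommGroup (V i)] [∀ i, Module K (V i)]

/-- Conjugation up to nonzero scalars preserves the stratum; the scalars leave room for the
determinants that appear when denominators are cleared. -/
theorem mem_stratum_of_semiconj {x f : HomShift K V} {r : Fin (n + 1) → ℕ}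
    (hx : x ∈ stratum K V r) (g : ∀ i, V i ≃ₗ[K] V i) (u : Fin (n + 1) → K) (hu : ∀ i, u i ≠ 0)
    (h : ∀ i v, f i (g i.castSucc v) = u i • g i.succ (x i v)) : f ∈ stratum K V r := by
  refine ⟨fun i w => ?_, ?_⟩
  · obtain ⟨v, rfl⟩ := (g i.castSucc.castSucc).surjective w
    have h1 := h i.castSucc v
    have h2 := h i.succ (x i.castSucc v)
    rw [hx.1 i v, map_zero, smul_zero] at h2
    rw [h1, map_smul]
    exact (congrArg _ h2).trans (smul_zero _)
  · rw [← hx.2]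
    ext i
    have h1 : f i ∘ₗ (g i.castSucc).toLinearMap = u i • ((g i.succ).toLinearMap ∘ₗ x i) :=
      LinearMap.ext (h i)
    have h2 : LinearMap.range (f i) = (LinearMap.range (x i)).map (g i.succ).toLinearMap := by
      rw [← LinearMap.range_comp_of_range_eq_top (f i) (LinearEquiv.range (g i.castSucc)), h1,
        LinearMap.range_smul _ _ (hu i), LinearMap.range_comp]
    rw [rk, h2]
    exact LinearEquiv.finrank_map_eq (g i.succ) _

variable [∀ i, FiniteDimensional K (V i)]

theorem rk_le_finrank (d : HomShift K V) (i : Fin (n + 1)) :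
    rk d i ≤ Module.finrank K (V i.succ) :=
  Submodule.finrank_le _

theorem rk_le_finrank_castSucc (d : HomShift K V) (i : Fin (n + 1)) :
    rk d i ≤ Module.finrank K (V i.castSucc) :=
  LinearMap.finrank_range_le _

theorem SquareZero.rk_add_rk_le {d : HomShift K V} (hd : SquareZero d) (i : Fin n) :
    rk d i.castSucc + rk d i.succ ≤ Module.finrank K (V i.succ.castSucc) := by
  rw [← LinearMap.finrank_range_add_finrank_ker (d i.succ), add_comm]
  refine Nat.add_le_add_left (Submodule.finrank_mono ?_) _
  rintro _ ⟨v, rfl⟩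
  exact hd i v

theorem finrank_range_eq_of_basis {W₁ W₂ : Type*} [AddCommGroup W₁] [Module K W₁]
    [AddCommGroup W₂] [Module K W₂] {m₁ m₂ s : ℕ} (b₁ : Module.Basis (Fin m₁) K W₁)
    (b₂ : Module.Basis (Fin m₂) K W₂) (f : W₁ →ₗ[K] W₂) (h₁ : s ≤ m₁) (h₂ : s ≤ m₂)
    (hlt : ∀ j, (j.rev : ℕ) < s → ∃ u : K, u ≠ 0 ∧
      ∀ k : Fin m₂, (k : ℕ) = j.rev → f (b₁ j) = u • b₂ k)
    (hge : ∀ j, s ≤ (j.rev : ℕ) → f (b₁ j) = 0) :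
    Module.finrank K (LinearMap.range f) = s := by
  have hli : LinearIndependent K (b₂ ∘ Fin.castLE h₂) :=
    b₂.linearIndependent.comp _ (Fin.castLE_injective h₂)
  have : LinearMap.range f = Submodule.span K (Set.range (b₂ ∘ Fin.castLE h₂)) := by
    apply le_antisymm
    · rw [LinearMap.range_eq_map, ← b₁.span_eq, Submodule.map_span, Submodule.span_le]
      rintro _ ⟨_, ⟨j, rfl⟩, rfl⟩
      rcases lt_or_ge (j.rev : ℕ) s with h | h
      · obtain ⟨u, -, hu⟩ := hlt j h
        rw [hu (Fin.castLE h₂ ⟨j.rev, h⟩) rfl]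
        exact Submodule.smul_mem _ _ (Submodule.subset_span ⟨_, rfl⟩)
      · rw [hge j h]
        exact zero_mem _
    · rw [Submodule.span_le]
      rintro _ ⟨k, rfl⟩
      obtain ⟨u, hu0, hu⟩ := hlt (Fin.castLE h₁ k).rev (by simp)
      refine ⟨u⁻¹ • b₁ (Fin.castLE h₁ k).rev, ?_⟩
      rw [map_smul, hu (Fin.castLE h₂ k) (by simp), inv_smul_smul₀ hu0]
      rfl
  rw [this, finrank_span_eq_card hli, Fintype.card_fin]

end Rank

/-! ### Closures and irreducibility of the strata. -/

section Strata

variable {K : Type*} [Field K] {n : ℕ} {V : Fin (n + 2) → Type*}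
  [∀ i, AddCommGroup (V i)] [∀ i, Module K (V i)] [∀ i, FiniteDimensional K (V i)]

/-- Differentials of the same rank are conjugate. -/
theorem exists_conj {x y : HomShift K V} (hx : SquareZero x) (hy : SquareZero y)
    (hxy : rk x = rk y) :
    ∃ g : ∀ i, V i ≃ₗ[K] V i, ∀ i v, y i (g i.castSucc v) = g i.succ (x i v) := by
  obtain ⟨b, hb⟩ := hx.exists_isAdapted
  obtain ⟨b', hb'⟩ := hy.exists_isAdapted
  refine ⟨fun i => (b i).equiv (b' i) (Equiv.refl _), fun i => ?_⟩
  suffices h : y i ∘ₗ ((b i.castSucc).equiv (b' i.castSucc) (Equiv.refl _)).toLinearMap =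
      ((b i.succ).equiv (b' i.succ) (Equiv.refl _)).toLinearMap ∘ₗ x i from LinearMap.congr_fun h
  refine (b i.castSucc).ext fun j => ?_
  rcases lt_or_ge (j.rev : ℕ) (rk x i) with h | h
  · let k : Fin (Module.finrank K (V i.succ)) := ⟨j.rev, h.trans_le (rk_le_finrank x i)⟩
    have h1 := (hb i j).1 k rfl h
    have h2 := (hb' i j).1 k rfl (by rwa [← hxy])
    simp [h1, h2]
  · have h1 := (hb i j).2 h
    have h2 := (hb' i j).2 (by rwa [← hxy])
    simp [h1, h2]

theorem stratum_subset_closure [Infinite K] {r t : Fin (n + 1) → ℕ}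
    (hr : (stratum K V r).Nonempty) (htr : t ≤ r) :
    stratum K V t ⊆ closure[zariski K (HomShift K V)] (stratum K V r) := by
  rintro d ⟨hd, rfl⟩
  obtain ⟨z, hz, rfl⟩ := hr
  obtain ⟨b, hb⟩ := hd.exists_isAdapted
  -- `e` supplies the matched pairs of basis vectors missing between rank `rk d` and rank `rk z`.
  let e : HomShift K V := fun i => (b i.castSucc).constr K fun j =>
    if h : rk d i ≤ j.rev ∧ (j.rev : ℕ) < rk z i then
      b i.succ ⟨j.rev, h.2.trans_le (rk_le_finrank z i)⟩ else 0
  have hlt : ∀ (a : K), a ≠ 0 → ∀ i j, (j.rev : ℕ) < rk z i → ∃ u : K, u ≠ 0 ∧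
      ∀ k : Fin _, (k : ℕ) = j.rev → (d + a • e) i (b i.castSucc j) = u • b i.succ k := by
    intro a ha i j hj
    rcases lt_or_ge (j.rev : ℕ) (rk d i) with h | h
    · refine ⟨1, one_ne_zero, fun k hk => ?_⟩
      have h1 := (hb i j).1 k hk (by omega)
      have h2 : e i (b i.castSucc j) = 0 := by
        simp only [e, Module.Basis.constr_basis]
        exact dif_neg fun h' => absurd h (not_lt.2 h'.1)
      simp [h1, h2]
    · refine ⟨a, ha, fun k hk => ?_⟩
      have h1 := (hb i j).2 h
      have h2 : e i (b i.castSucc j) = b i.succ k := by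
        simp only [e, Module.Basis.constr_basis]
        rw [dif_pos ⟨h, hj⟩]
        exact congrArg _ (Fin.ext hk.symm)
      simp [h1, h2]
  have hge : ∀ (a : K) i j, rk z i ≤ (j.rev : ℕ) → (d + a • e) i (b i.castSucc j) = 0 := by
    intro a i j hj
    have h1 := (hb i j).2 ((htr i).trans hj)
    have h2 : e i (b i.castSucc j) = 0 := by
      simp only [e, Module.Basis.constr_basis]
      exact dif_neg fun h' => absurd h'.2 (not_lt.2 hj)
    simp [h1, h2]
  have hmem : ∀ a : K, a ≠ 0 → d + a • e ∈ stratum K V (rk z) := by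
    refine fun a ha => ⟨fun i => ?_, funext fun i => ?_⟩
    · suffices h : (d + a • e) i.succ ∘ₗ (d + a • e) i.castSucc = 0 from LinearMap.congr_fun h
      refine (b i.castSucc.castSucc).ext fun j => ?_
      rw [LinearMap.comp_apply, LinearMap.zero_apply]
      rcases lt_or_ge (j.rev : ℕ) (rk z i.castSucc) with h | h
      · obtain ⟨u, -, hu⟩ := hlt a ha i.castSucc j h
        have hk := hu ⟨j.rev, h.trans_le (rk_le_finrank z i.castSucc)⟩ rfl
        -- Since the two ranks of `z` fit together in the dimension of the middle space, the initial
        -- vectors that are hit are disjoint from the final vectors that are not killed.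
        have h3 := hz.rk_add_rk_le i
        have h4 := hge a i.succ ⟨j.rev, h.trans_le (rk_le_finrank z i.castSucc)⟩
          (by rw [Fin.val_rev]; dsimp only; omega)
        rw [hk, map_smul]
        exact (congrArg _ h4).trans (smul_zero u)
      · rw [hge a i.castSucc j h, map_zero]
    · exact finrank_range_eq_of_basis (b i.castSucc) (b i.succ) _ (rk_le_finrank_castSucc z i)
        (rk_le_finrank z i) (hlt a ha i) (hge a i)
  have hc := IsPolyCurve.add_smul (K := K) d e
  simpa using hc.mem_closure ((Set.finite_singleton (0 : K)).subset fun a ha =>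
    by_contra fun h => ha (hmem a h)) 0

/-- Interpolate linearly from the identity to an automorphism `g` carrying `x` to `y`, and conjugate
`x` along the way. The adjugate replaces the inverse to keep the curve polynomial. -/
theorem exists_isPolyCurve_stratum [Infinite K] {r : Fin (n + 1) → ℕ} {x y : HomShift K V}
    (hx : x ∈ stratum K V r) (hy : y ∈ stratum K V r) :
    ∃ c : K → HomShift K V, IsPolyCurve K c ∧ {a | c a ∉ stratum K V r}.Finite ∧
      x ∈ Set.range c ∧ y ∈ Set.range c := by
  classical
  obtain ⟨g, hg⟩ := exists_conj hx.1 hy.1 (hx.2.trans hy.2.symm)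
  let b i := Module.finBasis K (V i)
  let G i := LinearMap.toMatrix (b i) (b i) (g i).toLinearMap
  let N i := LinearMap.toMatrix (b i.castSucc) (b i.succ) (x i)
  let N' i := LinearMap.toMatrix (b i.castSucc) (b i.succ) (y i)
  have hGN : ∀ i, N' i * G i.castSucc = G i.succ * N i := fun i => by
    simp only [G, N, N', ← LinearMap.toMatrix_comp]
    exact congrArg _ (LinearMap.ext (hg i))
  have hG : ∀ i, (G i).det ≠ 0 := fun i => by
    simp only [G, LinearMap.det_toMatrix]
    exact (LinearEquiv.isUnit_det' (g i)).ne_zero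
  let Q i (a : K) := (1 - a) • 1 + a • G i
  -- `κ` corrects the determinant factor of the adjugate at both ends: it is `1` at `a = 0` and
  -- `(det G)⁻¹` at `a = 1`.
  let κ i (a : K) := (1 - a) + a * (G i)⁻¹.det
  let P i := (1 - Polynomial.X : Polynomial K) • 1 +
    (Polynomial.X : Polynomial K) • (G i).map Polynomial.C
  let κP i := (1 - Polynomial.X : Polynomial K) + Polynomial.X * Polynomial.C (G i)⁻¹.det
  have hQ : ∀ i a, (P i).map (Polynomial.evalRingHom a) = Q i a := fun i a => by
    ext p q
    by_cases hpq : p = q <;> simp [P, Q, hpq, mul_comm a]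
  have hκ : ∀ i a, (κP i).eval a = κ i a := fun i a => by simp [κP, κ, mul_comm a]
  have hQ0 : ∀ i, Q i 0 = 1 := fun i => by simp [Q]
  have hQ1 : ∀ i, Q i 1 = G i := fun i => by simp [Q]
  let M i (a : K) := κ i.castSucc a • (Q i.succ a * N i * (Q i.castSucc a).adjugate)
  let MP i := κP i.castSucc • (P i.succ * (N i).map Polynomial.C * (P i.castSucc).adjugate)
  have hM : ∀ i a, (MP i).map (Polynomial.evalRingHom a) = M i a := fun i a => by
    simp only [M]
    have hN : ((N i).map Polynomial.C).map (Polynomial.evalRingHom a) = N i := by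
      ext; simp
    have hadj : (P i.castSucc).adjugate.map (Polynomial.evalRingHom a) =
        (Q i.castSucc a).adjugate := by
      rw [← hQ]
      exact RingHom.map_adjugate _ _
    rw [← hκ, ← hadj, ← hQ, ← hN, ← Matrix.map_mul, ← Matrix.map_mul]
    ext p q
    simp [MP]
  refine ⟨fun a i => Matrix.toLin (b i.castSucc) (b i.succ) (M i a), ?_, ?_, ⟨0, ?_⟩, ⟨1, ?_⟩⟩
  · refine IsPolyCurve.pi fun i => ?_
    have := (isPolyCurve_matrix (MP i)).map
      (Matrix.toLin (b i.castSucc) (b i.succ)).toLinearMap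
    simp only [hM] at this
    exact this
  -- Both polynomials take the value `1` at `0`, so they are nonzero and have finitely many roots.
  · have hfin : (⋃ i, ({a | (P i).det.IsRoot a} ∪ {a | (κP i).IsRoot a})).Finite := by
      refine Set.finite_iUnion fun i => (Polynomial.finite_setOfPred_isRoot ?_).union
        (Polynomial.finite_setOfPred_isRoot ?_)
      · intro h0
        have := congrArg (Polynomial.evalRingHom 0) h0
        rw [RingHom.map_det, RingHom.mapMatrix_apply, hQ, hQ0] at this
        simp at this
      · intro h0
        have := hκ i 0
        simp [h0, κ] at this
    refine hfin.subset fun a ha => by_contra fun hcon => ha ?_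
    simp only [Set.mem_iUnion, not_exists, Set.mem_union, not_or, Set.mem_ofPred_eq] at hcon
    have hdet : ∀ i, (Q i a).det ≠ 0 := fun i h => (hcon i).1 (by
      rw [← hQ] at h
      exact ((Polynomial.evalRingHom a).map_det (P i)).trans h)
    have hκ0 : ∀ i, κ i a ≠ 0 := fun i h => (hcon i).2 ((hκ i a).trans h)
    refine mem_stratum_of_semiconj hx
      (fun i => Matrix.toLinearEquiv (b i) (Q i a) (hdet i).isUnit)
      (fun i => κ i.castSucc a * (Q i.castSucc a).det)
      (fun i => mul_ne_zero (hκ0 _) (hdet _)) fun i v => ?_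
    suffices h : Matrix.toLin (b i.castSucc) (b i.succ) (M i a) ∘ₗ
        Matrix.toLin (b i.castSucc) (b i.castSucc) (Q i.castSucc a) =
        (κ i.castSucc a * (Q i.castSucc a).det) •
          (Matrix.toLin (b i.succ) (b i.succ) (Q i.succ a) ∘ₗ x i) from LinearMap.congr_fun h v
    have hxN : x i = Matrix.toLin (b i.castSucc) (b i.succ) (N i) :=
      (Matrix.toLin_toMatrix _ _ _).symm
    rw [hxN, ← Matrix.toLin_mul, ← Matrix.toLin_mul, ← map_smul]
    congr 1
    simp only [M]
    rw [Matrix.smul_mul, Matrix.mul_assoc, Matrix.adjugate_mul, Matrix.mul_smul, Matrix.mul_one,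
      smul_smul]
  · ext1 i
    simp [M, hQ0, κ, N]
  · ext1 i
    have hMN : M i 1 = N' i := by
      simp only [M, hQ1, ← hGN]
      rw [Matrix.mul_assoc, Matrix.mul_adjugate, Matrix.mul_smul, Matrix.mul_one, smul_smul]
      have : κ i.castSucc 1 * (G i.castSucc).det = 1 := by
        simp [κ, Matrix.det_nonsing_inv, hG]
      rw [this, one_smul]
    simp only [hMN]
    exact Matrix.toLin_toMatrix _ _ _

theorem isIrreducible_stratum [Infinite K] {r : Fin (n + 1) → ℕ}
    (hr : (stratum K V r).Nonempty) :
    @IsIrreducible _ (zariski K (HomShift K V)) (stratum K V r) :=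
  isIrreducible_of_isPolyCurve hr fun _ hx _ hy => exists_isPolyCurve_stratum hx hy

theorem closure_stratum [Infinite K] {r : Fin (n + 1) → ℕ} (hr : (stratum K V r).Nonempty) :
    closure[zariski K (HomShift K V)] (stratum K V r) = {d | SquareZero d ∧ rk d ≤ r} := by
  let := zariski K (HomShift K V)
  apply subset_antisymm
  · exact closure_minimal (fun d hd => ⟨hd.1, hd.2.le⟩) (isClosed_setOf_squareZero_and_rk_le r)
  · exact fun d hd => stratum_subset_closure hr hd.2 ⟨hd.1, rfl⟩

theorem closure_stratum_subset_closure_iff [Infinite K] {r s : Fin (n + 1) → ℕ}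
    (hr : (stratum K V r).Nonempty) (hs : (stratum K V s).Nonempty) :
    closure[zariski K (HomShift K V)] (stratum K V r) ⊆
      closure[zariski K (HomShift K V)] (stratum K V s) ↔ r ≤ s := by
  rw [closure_stratum hr, closure_stratum hs]
  constructor
  · intro h
    obtain ⟨d, hd, rfl⟩ := hr
    exact (h ⟨hd, le_rfl⟩).2
  · exact fun h d hd => ⟨hd.1, hd.2.trans h⟩

variable (K V) in
theorem finite_setOf_stratum_nonempty : {r | (stratum K V r).Nonempty}.Finite := by
  refine (Set.finite_Iic fun i : Fin (n + 1) => Module.finrank K (V i.succ)).subset ?_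
  rintro _ ⟨d, -, rfl⟩
  exact rk_le_finrank d

/-- An irreducible set of differentials lies in the closure of a maximal stratum. -/
theorem exists_maximal_subset_closure_stratum [Infinite K] {Y : Set (HomShift K V)}
    (hY : @IsIrreducible _ (zariski K (HomShift K V)) Y) (hYc : Y ⊆ complexes K V) :
    ∃ r, Maximal (fun s => (stratum K V s).Nonempty) r ∧
      Y ⊆ closure[zariski K (HomShift K V)] (stratum K V r) := by
  classical
  let := zariski K (HomShift K V)
  have hfin := finite_setOf_stratum_nonempty K V
  -- An irreducible set covered by finitely many closed sets lies in one of them.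
  obtain ⟨_, hz, hYz⟩ := isIrreducible_iff_sUnion_isClosed.1 hY
    (hfin.toFinset.image fun r => closure (stratum K V r)) (by simp) (fun d hd => by
      have : (stratum K V (rk d)).Nonempty := ⟨d, hYc hd, rfl⟩
      refine ⟨closure (stratum K V (rk d)), ?_, subset_closure ⟨hYc hd, rfl⟩⟩
      simp only [Finset.coe_image, Set.Finite.coe_toFinset]
      exact ⟨_, this, rfl⟩)
  obtain ⟨s, hs, rfl⟩ := Finset.mem_image.1 hz
  have hs' : (stratum K V s).Nonempty := by simpa using hs
  obtain ⟨r, hsr, hr⟩ := hfin.exists_le_maximal hs'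
  exact ⟨r, hr, hYz.trans ((closure_stratum_subset_closure_iff hs' hr.1).2 hsr)⟩

end Strata

end VarietyOfComplexes

/-! ### Closures of strata and components of the variety of complexes. -/

theorem proposition17 {K : Type*} [Field K] [IsAlgClosed K] {n : ℕ}
    (V : Fin (n + 2) → Type*) [∀ i, AddCommGroup (V i)] [∀ i, Module K (V i)]
    [∀ i, FiniteDimensional K (V i)] :
    (∀ r : Fin (n + 1) → ℕ, (VarietyOfComplexes.stratum K V r).Nonempty →
      closure[VarietyOfComplexes.zariski K (VarietyOfComplexes.HomShift K V)]
          (VarietyOfComplexes.stratum K V r)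
        = ⋃ (t : Fin (n + 1) → ℕ) (_ : t ≤ r), VarietyOfComplexes.stratum K V t ∧
      closure[VarietyOfComplexes.zariski K (VarietyOfComplexes.HomShift K V)]
          (VarietyOfComplexes.stratum K V r)
        = {d | VarietyOfComplexes.SquareZero d ∧ VarietyOfComplexes.rk d ≤ r}) ∧
    Set.BijOn
      (fun r : Fin (n + 1) → ℕ =>
        closure[VarietyOfComplexes.zariski K (VarietyOfComplexes.HomShift K V)]
          (VarietyOfComplexes.stratum K V r))
      {r | Maximal (fun s : Fin (n + 1) → ℕ => (VarietyOfComplexes.stratum K V s).Nonempty) r}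
      (VarietyOfComplexes.components K (VarietyOfComplexes.complexes K V)) := by
  open VarietyOfComplexes in
  let := zariski K (HomShift K V)
  refine ⟨fun r hr => ⟨?_, closure_stratum hr⟩, ?_⟩
  · rw [closure_stratum hr]
    ext d
    simp only [Set.mem_ofPred_eq, Set.mem_iUnion, stratum]
    exact ⟨fun h => ⟨rk d, h.2, h.1, rfl⟩, fun ⟨t, ht, h, h'⟩ => ⟨h, h' ▸ ht⟩⟩
  have hcomp : components K (complexes K V) =
      {Y | Maximal (fun s => IsIrreducible s ∧ s ⊆ complexes K V) Y} :=
    image_irreducibleComponents _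
  have hsub : ∀ r, closure (stratum K V r) ⊆ complexes K V := fun r =>
    closure_minimal (fun d hd => hd.1) isClosed_complexes
  rw [hcomp]
  refine ⟨fun r hr => ⟨⟨(isIrreducible_stratum hr.1).closure, hsub r⟩, ?_⟩, ?_, ?_⟩
  · rintro Y ⟨hY, hYc⟩ hrY
    obtain ⟨s, hs, hYs⟩ := exists_maximal_subset_closure_stratum hY hYc
    have hrs : r ≤ s := (closure_stratum_subset_closure_iff hr.1 hs.1).1 (hrY.trans hYs)
    exact hYs.trans ((closure_stratum_subset_closure_iff hs.1 hr.1).2 (hr.2 hs.1 hrs))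
  · exact fun r hr s hs h => le_antisymm
      ((closure_stratum_subset_closure_iff hr.1 hs.1).1 h.subset)
      ((closure_stratum_subset_closure_iff hs.1 hr.1).1 h.superset)
  · rintro Y ⟨⟨hY, hYc⟩, hmax⟩
    obtain ⟨s, hs, hYs⟩ := exists_maximal_subset_closure_stratum hY hYc
    exact ⟨s, hs, (hmax ⟨(isIrreducible_stratum hs.1).closure, hsub s⟩ hYs).antisymm hYs⟩
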